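/- Let $\mathcal B$ be a Krull-Schmidt exact category with enough projectives and enough injectives. A cotorsion pair in $\mathcal B$ is a pair $(\mathcal U,\mathcal V)$ of full additive subcategories closed under direct summands such that $\operatorname{Ext}^1_{\mathcal B}(\mathcal U,\mathcal V)=0$ and every object $B$ admits short exact sequences $V_B\rightarrowtail U_B\twoheadrightarrow B$ and $B\rightarrowtail V^B\twoheadrightarrow U^B$ with $U_B,U^B\in\mathcal U$ and $V_B,V^B\in\mathcal V$; it is hereditary if $\operatorname{Ext}^i_{\mathcal B}(\mathcal U,\mathcal V)=0$ for all $i>0$. Let $(\mathcal S,\mathcal T),(\mathcal U,\mathcal V)$ be a twin cotorsion pair, i.e. two cotorsion pairs with $\mathcal S\subseteq\mathcal U$. Put $\mathcal W=\mathcal T\cap\mathcal U$. Let $\mathcal B^+$ be the full subcategory of the objects $B$ that admit a short exact sequence $V\rightarrowtail W\twoheadrightarrow B$ with $V\in\mathcal V$, $W\in\mathcal W$, let $\mathcal B^-$ be the full subcategory of the objects $B$ that admit a short exact sequence $B\rightarrowtail W\twoheadrightarrow S$ with $W\in\mathcal W$, $S\in\mathcal S$, and let the heart be the ideal quotient $(\mathcal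 B^+\cap\mathcal B^-)/\mathcal W$, in which morphisms that factor through an object of $\mathcal W$ are set to zero. If $(\mathcal S,\mathcal T)$ or $(\mathcal U,\mathcal V)$ is hereditary, then the heart is zero. Moreover, if $(\mathcal S,\mathcal T)$ is hereditary then $\mathcal B^+=\mathcal T$, and if $(\mathcal U,\mathcal V)$ is hereditary then $\mathcal B^-=\mathcal U$. -/

import Mathlib

open CategoryTheory CategoryTheory.Limits

universe v u

/-- `f` is an inflation for a class `conf` of short exact sequences. -/
def IsInflation {C : Type u} [Category.{v} C] [Preadditive C]
    (conf : ObjectProperty (ShortComplex C)) {X Y : C} (f : X ⟶ Y) : Prop :=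
  ∃ (Z : C) (d : Y ⟶ Z) (w : f ≫ d = 0), conf (ShortComplex.mk f d w)

/-- `f` is a deflation for a class `conf` of short exact sequences. -/
def IsDeflation {C : Type u} [Category.{v} C] [Preadditive C]
    (conf : ObjectProperty (ShortComplex C)) {X Y : C} (f : X ⟶ Y) : Prop :=
  ∃ (Z : C) (i : Z ⟶ X) (w : i ≫ f = 0), conf (ShortComplex.mk i f w)

/-- A Quillen exact structure on an additive category `C`: a class of kernel-cokernel pairs (the
short exact sequences, or conflations), stable under isomorphisms, direct sums and direct summands,
subject to the usual axioms. -/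
structure ExactStructure (C : Type u) [Category.{v} C] [Preadditive C]
    [HasZeroObject C] [HasBinaryBiproducts C] where
  /-- the class of short exact sequences -/
  conf : ObjectProperty (ShortComplex C)
  isKernel : ∀ S : ShortComplex C, conf S → Nonempty (IsLimit (KernelFork.ofι S.f S.zero))
  isCokernel : ∀ S : ShortComplex C, conf S → Nonempty (IsColimit (CokernelCofork.ofπ S.g S.zero))
  conf_of_iso : ∀ S S' : ShortComplex C, Nonempty (S ≅ S') → conf S → conf S'
  conf_sum : ∀ (S S' : ShortComplex C)
    (w : biprod.map S.f S'.f ≫ biprod.map S.g S'.g = 0), conf S → conf S' →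
      conf (ShortComplex.mk (biprod.map S.f S'.f) (biprod.map S.g S'.g) w)
  conf_summand : ∀ (S S' : ShortComplex C)
    (w : biprod.map S.f S'.f ≫ biprod.map S.g S'.g = 0),
      conf (ShortComplex.mk (biprod.map S.f S'.f) (biprod.map S.g S'.g) w) → conf S
  inflation_id : ∀ X : C, IsInflation conf (𝟙 X)
  deflation_id : ∀ X : C, IsDeflation conf (𝟙 X)
  inflation_comp : ∀ {X Y Z : C} (f : X ⟶ Y) (g : Y ⟶ Z),
    IsInflation conf f → IsInflation conf g → IsInflation conf (f ≫ g)
  deflation_comp : ∀ {X Y Z : C} (f : X ⟶ Y) (g : Y ⟶ Z),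
    IsDeflation conf f → IsDeflation conf g → IsDeflation conf (f ≫ g)
  /-- deflations have pull-backs along arbitrary morphisms, and these are deflations -/
  pullback : ∀ {Y Z Z' : C} (d : Y ⟶ Z) (f : Z' ⟶ Z), IsDeflation conf d →
    ∃ (Y' : C) (f' : Y' ⟶ Y) (d' : Y' ⟶ Z'), IsPullback f' d' d f ∧ IsDeflation conf d'
  /-- inflations have push-outs along arbitrary morphisms, and these are inflations -/
  pushout : ∀ {X Y X' : C} (i : X ⟶ Y) (g : X ⟶ X'), IsInflation conf i →
    ∃ (Y' : C) (g' : Y ⟶ Y') (i' : X' ⟶ Y'), IsPushout i g g' i' ∧ IsInflation conf i'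

/-- Every object is a finite direct sum of objects with local endomorphism rings. -/
def IsKrullSchmidt (C : Type u) [Category.{v} C] [Preadditive C] : Prop :=
  ∀ X : C, ∃ (n : ℕ) (F : Fin n → C) (b : Bicone F),
    (∀ i, IsLocalRing (End (F i))) ∧ Nonempty b.IsBilimit ∧ Nonempty (X ≅ b.pt)

/-- A full additive subcategory that is closed under direct summands. -/
structure IsAdditiveSummandClosed {C : Type u} [Category.{v} C] [Preadditive C]
    [HasBinaryBiproducts C] (P : ObjectProperty C) : Prop where
  zero : ∃ Z : C, IsZero Z ∧ P Z
  sum : ∀ X Y : C, P X → P Y → P (X ⊞ Y)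
  summand : ∀ X Y Z : C, Nonempty (Z ≅ X ⊞ Y) → P Z → P X

/-- Two parallel morphisms are identified when their difference factors through an object of `W`. -/
def factorRel {C : Type u} [Category.{v} C] [Preadditive C] (W : ObjectProperty C) : HomRel C :=
  fun X Y f g => ∃ (Z : C) (a : X ⟶ Z) (b : Z ⟶ Y), W Z ∧ f - g = a ≫ b

/-- The quotient `H / W`: the full subcategory of the ideal quotient `C / W` on the objects
of `H`. -/
abbrev QuotientSubcategory {C : Type u} [Category.{v} C] [Preadditive C]
    (H W : ObjectProperty C) : Type u :=
  ObjectProperty.FullSubcategory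
    (fun X : CategoryTheory.Quotient (factorRel W) => H X.as)

/-- A category is zero if it has an object and all its objects are zero objects. -/
def IsZeroCategory (A : Type u) [Category.{v} A] : Prop :=
  Nonempty A ∧ ∀ X : A, IsZero X

namespace ExactStructure

variable {C : Type u} [Category.{v} C] [Preadditive C]
variable [HasZeroObject C] [HasBinaryBiproducts C]
variable (E : ExactStructure C)

/-- `P` is projective with respect to deflations. -/
def IsProjective (P : C) : Prop :=
  ∀ (X Y : C) (f : X ⟶ Y) (g : P ⟶ Y), IsDeflation E.conf f → ∃ h : P ⟶ X, h ≫ f = g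

/-- `I` is injective with respect to inflations. -/
def IsInjective (I : C) : Prop :=
  ∀ (X Y : C) (f : X ⟶ Y) (g : X ⟶ I), IsInflation E.conf f → ∃ h : Y ⟶ I, f ≫ h = g

/-- Every object is the target of a deflation from a projective object. -/
def HasEnoughProjectives : Prop :=
  ∀ X : C, ∃ (P : C) (p : P ⟶ X), E.IsProjective P ∧ IsDeflation E.conf p

/-- Every object is the source of an inflation into an injective object. -/
def HasEnoughInjectives : Prop :=
  ∀ X : C, ∃ (I : C) (i : X ⟶ I), E.IsInjective I ∧ IsInflation E.conf i

/-- A short exact sequence `Y ↣ M ↠ X` with prescribed end terms. -/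
structure Conflation (Y X : C) where
  /-- the middle term -/
  M : C
  /-- the inflation -/
  i : Y ⟶ M
  /-- the deflation -/
  d : M ⟶ X
  zero : i ≫ d = 0
  conf : E.conf (ShortComplex.mk i d zero)

/-- Yoneda extensions of degree `n` of `X` by `Y`: morphisms `X ⟶ Y` for `n = 0`, and for `n ≥ 1`
exact sequences `Y ↣ Mₙ → ⋯ → M₁ ↠ X`, given as spliced short exact sequences. -/
def YonedaExtension (X : C) : ℕ → C → Type (max u v)
  | 0, Y => ULift.{max u v} (X ⟶ Y)
  | 1, Y => E.Conflation Y X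
  | n + 2, Y => Σ Z : C, E.Conflation Y Z × YonedaExtension X (n + 1) Z

/-- There is a morphism of Yoneda extensions which is `f` on the left end term and the identity
on the right end term `X`. -/
def YonedaMap (X : C) : ∀ (n : ℕ) {Y Y' : C} (_ : Y ⟶ Y'),
    E.YonedaExtension X n Y → E.YonedaExtension X n Y' → Prop
  | 0, _, _, f, a, b => a.down ≫ f = b.down
  | 1, _, _, f, a, b => ∃ g : a.M ⟶ b.M, a.i ≫ g = f ≫ b.i ∧ g ≫ b.d = a.d
  | n + 2, _, _, f, a, b => ∃ (g : a.2.1.M ⟶ b.2.1.M) (h : a.1 ⟶ b.1),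
      a.2.1.i ≫ g = f ≫ b.2.1.i ∧ g ≫ b.2.1.d = a.2.1.d ≫ h ∧
        YonedaMap X (n + 1) h a.2.2 b.2.2

/-- `Extⁿ(X, Y)`: Yoneda extensions of degree `n`, modulo the equivalence relation generated by
morphisms of extensions that are identities on both end terms. -/
def Ext (n : ℕ) (X Y : C) : Type (max u v) :=
  Quot (E.YonedaMap X n (𝟙 Y))

/-- `Extⁿ(U, V) = 0`. Since `Extⁿ` always contains the class of the trivial extension, it vanishes
exactly if it has at most one element. -/
def ExtVanishes (n : ℕ) (U V : ObjectProperty C) : Prop :=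
  ∀ X Y : C, U X → V Y → Subsingleton (E.Ext n X Y)

/-- `(U, V)` is a cotorsion pair. -/
structure IsCotorsionPair (U V : ObjectProperty C) : Prop where
  left : IsAdditiveSummandClosed U
  right : IsAdditiveSummandClosed V
  ext_one : E.ExtVanishes 1 U V
  exists_left : ∀ B : C, ∃ (V' U' : C) (i : V' ⟶ U') (d : U' ⟶ B) (w : i ≫ d = 0),
    V V' ∧ U U' ∧ E.conf (ShortComplex.mk i d w)
  exists_right : ∀ B : C, ∃ (V' U' : C) (i : B ⟶ V') (d : V' ⟶ U') (w : i ≫ d = 0),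
    V V' ∧ U U' ∧ E.conf (ShortComplex.mk i d w)

/-- `(U, V)` is hereditary: `Extⁱ(U, V) = 0` for all `i > 0`. -/
def IsHereditary (U V : ObjectProperty C) : Prop :=
  ∀ i : ℕ, 0 < i → E.ExtVanishes i U V

/-- `(S, T), (U, V)` is a twin cotorsion pair. -/
structure IsTwinCotorsionPair (S T U V : ObjectProperty C) : Prop where
  fst : E.IsCotorsionPair S T
  snd : E.IsCotorsionPair U V
  le : S ≤ U

/-- The subcategory `B⁺`: objects `B` with a short exact sequence `V' ↣ W' ↠ B` with
`V' ∈ V` and `W' ∈ T ∩ U`. -/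
def plus (T U V : ObjectProperty C) : ObjectProperty C := fun B =>
  ∃ (V' W' : C) (i : V' ⟶ W') (d : W' ⟶ B) (w : i ≫ d = 0),
    V V' ∧ (T ⊓ U) W' ∧ E.conf (ShortComplex.mk i d w)

/-- The subcategory `B⁻`: objects `B` with a short exact sequence `B ↣ W' ↠ S'` with
`W' ∈ T ∩ U` and `S' ∈ S`. -/
def minus (S T U : ObjectProperty C) : ObjectProperty C := fun B =>
  ∃ (W' S' : C) (i : B ⟶ W') (d : W' ⟶ S') (w : i ≫ d = 0),
    (T ⊓ U) W' ∧ S S' ∧ E.conf (ShortComplex.mk i d w)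

/-- The heart `(B⁺ ∩ B⁻) / (T ∩ U)`. -/
abbrev Heart (S T U V : ObjectProperty C) : Type u :=
  QuotientSubcategory (E.plus T U V ⊓ E.minus S T U) (T ⊓ U)

end ExactStructure

open scoped ZeroObject

namespace ExactStructure

variable {C : Type u} [Category.{v} C] [Preadditive C]
variable [HasZeroObject C] [HasBinaryBiproducts C]
variable (E : ExactStructure C)

/-! ### Elementary properties of conflations and splitting. -/

section Conflations

variable {E} {Y M X : C} {i : Y ⟶ M} {d : M ⟶ X} {w : i ≫ d = 0}

/-! Membership in either half of a cotorsion pair is detected by splitting of extensions, and `S ≤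
U` gives `V ≤ T`. If `V' ↣ W' ↠ B` exhibits `B` in `B⁺`, then `Ext¹(S, B)` lies between `Ext¹(S, W')
= 0` and `Ext²(S, V')`, which is zero when `(S, T)` is hereditary; so `B` is in `T`. If `B` is also
in `B⁻`, its conflation `B ↣ W' ↠ S'` splits, so `B` is a summand of `W'` and dies in the heart. The
case of `(U, V)` is dual.

The work lies in the exactness step, `Splits.quotient` and `Splits.subobject`. Vanishing of Yoneda
`Ext²` only joins an extension to the trivial one by a zigzag of morphisms. What is needed is
therefore a property preserved along morphisms in both directions: `ProjectiveLift`, dually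
`InjectiveExtension`, which says that the obstruction computed from a projective or injective
presentation vanishes. -/

lemma exists_lift (hc : E.conf (ShortComplex.mk i d w)) {A : C} (k : A ⟶ M) (hk : k ≫ d = 0) :
    ∃ l : A ⟶ Y, l ≫ i = k := by
  obtain ⟨hl⟩ := E.isKernel _ hc
  exact ⟨KernelFork.IsLimit.lift' hl k hk |>.1, KernelFork.IsLimit.lift' hl k hk |>.2⟩

lemma exists_desc (hc : E.conf (ShortComplex.mk i d w)) {A : C} (k : M ⟶ A) (hk : i ≫ k = 0) :
    ∃ l : X ⟶ A, d ≫ l = k := by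
  obtain ⟨hl⟩ := E.isCokernel _ hc
  exact ⟨CokernelCofork.IsColimit.desc' hl k hk |>.1, CokernelCofork.IsColimit.desc' hl k hk |>.2⟩

lemma mono_of_conf (hc : E.conf (ShortComplex.mk i d w)) : Mono i := by
  obtain ⟨hl⟩ := E.isKernel _ hc
  exact mono_of_isLimit_fork hl

lemma epi_of_conf (hc : E.conf (ShortComplex.mk i d w)) : Epi d := by
  obtain ⟨hl⟩ := E.isCokernel _ hc
  exact epi_of_isColimit_cofork hl

lemma section_of_retraction (hc : E.conf (ShortComplex.mk i d w)) {r : M ⟶ Y} (hr : i ≫ r = 𝟙 Y) :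
    ∃ s : X ⟶ M, s ≫ d = 𝟙 X := by
  obtain ⟨s, hs⟩ := exists_desc hc (𝟙 M - r ≫ i) (by
    rw [Preadditive.comp_sub, reassoc_of% hr]; simp)
  have := epi_of_conf hc
  refine ⟨s, ?_⟩
  rw [← cancel_epi d, reassoc_of% hs]
  simp [w]

lemma retraction_of_section (hc : E.conf (ShortComplex.mk i d w)) {s : X ⟶ M} (hs : s ≫ d = 𝟙 X) :
    ∃ r : M ⟶ Y, i ≫ r = 𝟙 Y := by
  obtain ⟨r, hr⟩ := exists_lift hc (𝟙 M - d ≫ s) (by simp [hs])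
  have := mono_of_conf hc
  refine ⟨r, ?_⟩
  rw [← cancel_mono i, Category.assoc, hr, Preadditive.comp_sub, reassoc_of% w]
  simp

/-- The middle term of a split conflation is the direct sum of the end terms. -/
lemma nonempty_iso_biprod (hc : E.conf (ShortComplex.mk i d w)) {s : X ⟶ M} (hs : s ≫ d = 𝟙 X) :
    Nonempty (M ≅ Y ⊞ X) := by
  obtain ⟨r, hr⟩ := exists_lift hc (𝟙 M - d ≫ s) (by simp [hs])
  have := mono_of_conf hc
  have h1 : i ≫ r = 𝟙 Y := by
    rw [← cancel_mono i, Category.assoc, hr, Preadditive.comp_sub, reassoc_of% w]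
    simp
  have h2 : s ≫ r = 0 := by
    rw [← cancel_mono i, Category.assoc, hr, Preadditive.comp_sub, reassoc_of% hs]
    simp
  exact ⟨{ hom := biprod.lift r d
           inv := biprod.desc i s
           hom_inv_id := by simp [biprod.lift_desc, hr]
           inv_hom_id := by ext <;> simp [h1, h2, hs, w] }⟩

lemma conf_of_isos {Y' M' X' : C} {i' : Y' ⟶ M'} {d' : M' ⟶ X'} {w' : i' ≫ d' = 0}
    (hc : E.conf (ShortComplex.mk i d w)) (a : Y ≅ Y') (b : M ≅ M') (c : X ≅ X')
    (hab : a.hom ≫ i' = i ≫ b.hom) (hbc : b.hom ≫ d' = d ≫ c.hom) :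
    E.conf (ShortComplex.mk i' d' w') :=
  E.conf_of_iso _ _ ⟨ShortComplex.isoMk a b c hab hbc⟩ hc

end Conflations

lemma conf_id_zero {Z : C} (hZ : IsZero Z) (Y : C) :
    E.conf (ShortComplex.mk (𝟙 Y) (0 : Y ⟶ Z) (by simp)) := by
  obtain ⟨Z', d, w, hc⟩ := E.inflation_id Y
  have := epi_of_conf hc
  have hd : d = 0 := by simpa using w
  have hZ' : IsZero Z' := (IsZero.iff_id_eq_zero _).2 (by rw [← cancel_epi d, hd]; simp)
  exact conf_of_isos hc (Iso.refl _) (Iso.refl _) (hZ'.iso hZ) (by simp) (hZ.eq_of_tgt _ _)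

lemma conf_zero_id {Z : C} (hZ : IsZero Z) (X : C) :
    E.conf (ShortComplex.mk (0 : Z ⟶ X) (𝟙 X) (by simp)) := by
  obtain ⟨Z', i, w, hc⟩ := E.deflation_id X
  have := mono_of_conf hc
  have hi : i = 0 := by simpa using w
  have hZ' : IsZero Z' := (IsZero.iff_id_eq_zero _).2 (by rw [← cancel_mono i, hi]; simp)
  exact conf_of_isos hc (hZ'.iso hZ) (Iso.refl _) (Iso.refl _) (hZ'.eq_of_src _ _) (by simp)

lemma conf_biprod (Y X : C) :
    E.conf (ShortComplex.mk (biprod.inl : Y ⟶ Y ⊞ X) biprod.snd (by simp)) := by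
  have hz := isZero_zero C
  refine conf_of_isos (E.conf_sum _ _ (by ext; all_goals simp) (E.conf_id_zero hz Y)
    (E.conf_zero_id hz X)) (isoBiprodZero hz).symm (Iso.refl _) (isoZeroBiprod hz).symm ?_ ?_
  · ext <;> simp
  · ext <;> simp

/-- Every short exact sequence `Y ↣ M ↠ X` splits. -/
def Splits (X Y : C) : Prop :=
  ∀ a : E.Conflation Y X, ∃ s : X ⟶ a.M, s ≫ a.d = 𝟙 X

/-! ### Morphisms of conflations and vanishing of `Ext¹`. -/

variable {E}

/-- A morphism of conflations with equal left ends has a cartesian right square. -/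
lemma exists_lift_of_morphism {Y M Z M' Z' K : C} {i : Y ⟶ M} {d : M ⟶ Z} {w : i ≫ d = 0}
    {i' : Y ⟶ M'} {d' : M' ⟶ Z'} {w' : i' ≫ d' = 0} (hc : E.conf (ShortComplex.mk i d w))
    (hc' : E.conf (ShortComplex.mk i' d' w')) {g : M ⟶ M'} {z : Z ⟶ Z'} (hg : i ≫ g = i')
    (hz : g ≫ d' = d ≫ z) {k : K ⟶ Z} {k' : K ⟶ M'} (hk : k' ≫ d' = k ≫ z) :
    ∃ c : K ⟶ M, c ≫ d = k := by
  have := mono_of_conf hc'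
  obtain ⟨Q, f, q, hpb, B, b, wb, hb⟩ := E.pullback d k ⟨_, i, w, hc⟩
  have := epi_of_conf hb
  -- On the pullback `Q` of `d` and `k`, the maps to `M'` through `M` and through `K` differ by some
  -- `r : Q ⟶ Y`. Correcting `f` by `r ≫ i` makes it vanish on the kernel of `q`, so it descends to
  -- `K`.
  obtain ⟨r, hr⟩ := exists_lift hc' (f ≫ g - q ≫ k') (by
    simp [hz, hk, reassoc_of% hpb.w])
  obtain ⟨y, hy⟩ := exists_lift hc (b ≫ f) (by rw [Category.assoc, hpb.w, reassoc_of% wb]; simp)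
  have hry : b ≫ r = y := by
    rw [← cancel_mono i', Category.assoc, hr, Preadditive.comp_sub, reassoc_of% wb, ← hg,
      reassoc_of% hy]
    simp
  obtain ⟨c, hcq⟩ := exists_desc hb (f - r ≫ i) (by
    rw [Preadditive.comp_sub, reassoc_of% hry, hy, sub_self])
  refine ⟨c, ?_⟩
  rw [← cancel_epi q, reassoc_of% hcq]
  simp [w, hpb.w]

/-- A morphism of conflations with equal right ends has a cocartesian left square. -/
lemma exists_desc_of_morphism {Z N X Z' N' Q : C} {i : Z ⟶ N} {d : N ⟶ X} {w : i ≫ d = 0}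
    {i' : Z' ⟶ N'} {d' : N' ⟶ X} {w' : i' ≫ d' = 0} (hc : E.conf (ShortComplex.mk i d w))
    (hc' : E.conf (ShortComplex.mk i' d' w')) {n : N ⟶ N'} {z : Z ⟶ Z'} (hn : n ≫ d' = d)
    (hz : z ≫ i' = i ≫ n) {k : N ⟶ Q} {k' : Z' ⟶ Q} (hk : i ≫ k = z ≫ k') :
    ∃ c : N' ⟶ Q, i' ≫ c = k' := by
  have := epi_of_conf hc
  obtain ⟨R, f, q, hpo, B, b, wb, hb⟩ := E.pushout i' k' ⟨_, d', w', hc'⟩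
  have := mono_of_conf hb
  obtain ⟨r, hr⟩ := exists_desc hc (n ≫ f - k ≫ q) (by
    rw [Preadditive.comp_sub, reassoc_of% hk, ← reassoc_of% hz, hpo.w, sub_self])
  obtain ⟨y, hy⟩ := exists_desc hc' (f ≫ b) (by rw [reassoc_of% hpo.w, wb]; simp)
  have hry : r ≫ b = y := by
    rw [← cancel_epi d, reassoc_of% hr, ← hn, Category.assoc, hy]
    simp [wb]
  obtain ⟨c, hcq⟩ := exists_lift hb (f - d' ≫ r) (by
    rw [Preadditive.sub_comp, Category.assoc, hry, hy, sub_self])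
  refine ⟨c, ?_⟩
  rw [← cancel_mono q, Category.assoc, hcq]
  simp [reassoc_of% w', hpo.w]

/-- Splitting passes along morphisms of extensions in both directions: sections push forward,
retractions pull back. Hence it is well defined on classes. -/
lemma splits_of_ext_one {X Y : C} (h : Subsingleton (E.Ext 1 X Y)) : E.Splits X Y := by
  intro a
  let split : E.Conflation Y X → Prop := fun a => ∃ s : X ⟶ a.M, s ≫ a.d = 𝟙 X
  have hinv : ∀ a b : E.Conflation Y X, E.YonedaMap X 1 (𝟙 Y) a b → split a = split b := by
    rintro a b ⟨g, hg, hg'⟩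
    refine propext ⟨fun ⟨s, hs⟩ => ⟨s ≫ g, by rw [Category.assoc, hg', hs]⟩, fun ⟨s, hs⟩ => ?_⟩
    obtain ⟨r, hr⟩ := retraction_of_section b.conf hs
    exact section_of_retraction a.conf (r := g ≫ r) (by
      rw [reassoc_of% hg, hr])
  let b : E.Conflation Y X := ⟨_, _, _, _, E.conf_biprod Y X⟩
  have hab : (Quot.mk _ a : E.Ext 1 X Y) = Quot.mk _ b := h.elim _ _
  have : split a = split b :=
    congrArg (Quot.lift (r := E.YonedaMap X 1 (𝟙 Y)) split hinv) hab
  change split a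
  rw [this]
  exact ⟨biprod.inr, biprod.inr_snd⟩

lemma Splits.exists_extension {X Y : C} (h : E.Splits X Y) {K P : C} {j : K ⟶ P} {p : P ⟶ X}
    {w : j ≫ p = 0} (hc : E.conf (ShortComplex.mk j p w)) (k : K ⟶ Y) :
    ∃ l : P ⟶ Y, j ≫ l = k := by
  obtain ⟨Q, g, i', hpo, Z, d, wd, hd⟩ := E.pushout j k ⟨X, p, w, hc⟩
  have hZ := epi_of_conf hd
  have hX := epi_of_conf hc
  let q : Q ⟶ X := hpo.desc p 0 (by simp [w])
  have hgq : g ≫ q = p := hpo.inl_desc _ _ _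
  have hiq : i' ≫ q = 0 := hpo.inr_desc _ _ _
  obtain ⟨u, hu⟩ := exists_desc hd q hiq
  obtain ⟨t, ht⟩ := exists_desc hc (g ≫ d) (by
    rw [reassoc_of% hpo.w, wd]; simp)
  -- The axiom supplies only some cokernel `Z` of `i'`; it is identified with `X` here.
  have hqt : q ≫ t = d := by
    apply hpo.hom_ext
    · rw [reassoc_of% hgq, ht]
    · rw [reassoc_of% hiq, wd]; simp
  let e : Z ≅ X :=
    { hom := u
      inv := t
      hom_inv_id := by rw [← cancel_epi d, reassoc_of% hu, hqt]; simp
      inv_hom_id := by rw [← cancel_epi p, reassoc_of% ht, hu, hgq]; simp }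
  have hconf : E.conf (ShortComplex.mk i' q hiq) :=
    conf_of_isos hd (Iso.refl _) (Iso.refl _) e (by simp) (by simp [e, hu])
  obtain ⟨s, hs⟩ := h ⟨Q, i', q, hiq, hconf⟩
  obtain ⟨r, hr⟩ := retraction_of_section hconf hs
  exact ⟨g ≫ r, by rw [reassoc_of% hpo.w, hr]; simp⟩

lemma Splits.exists_lift {X Y : C} (h : E.Splits X Y) {I Q : C} {j : Y ⟶ I} {p : I ⟶ Q}
    {w : j ≫ p = 0} (hc : E.conf (ShortComplex.mk j p w)) (k : X ⟶ Q) :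
    ∃ l : X ⟶ I, l ≫ p = k := by
  obtain ⟨N, g, d', hpb, Z, i, wi, hi⟩ := E.pullback p k ⟨Y, j, w, hc⟩
  have hZ := mono_of_conf hi
  have hY := mono_of_conf hc
  let q : Y ⟶ N := hpb.lift j 0 (by simp [w])
  have hqg : q ≫ g = j := hpb.lift_fst _ _ _
  have hqd : q ≫ d' = 0 := hpb.lift_snd _ _ _
  obtain ⟨u, hu⟩ := ExactStructure.exists_lift hi q hqd
  obtain ⟨t, ht⟩ := ExactStructure.exists_lift hc (i ≫ g) (by
    rw [Category.assoc, hpb.w, reassoc_of% wi]; simp)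
  have htq : t ≫ q = i := by
    apply hpb.hom_ext
    · rw [Category.assoc, hqg, ht]
    · rw [Category.assoc, hqd, wi]; simp
  let e : Z ≅ Y :=
    { hom := t
      inv := u
      hom_inv_id := by rw [← cancel_mono i, Category.assoc, hu, htq]; simp
      inv_hom_id := by rw [← cancel_mono j, Category.assoc, ht, reassoc_of% hu, hqg]; simp }
  have hconf : E.conf (ShortComplex.mk q d' hqd) :=
    conf_of_isos hi e (Iso.refl _) (Iso.refl _) (by simp [e, htq]) (by simp)
  obtain ⟨s, hs⟩ := h ⟨N, q, d', hqd, hconf⟩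
  exact ⟨s ≫ g, by rw [Category.assoc, hpb.w, reassoc_of% hs]⟩

/-- A lift of `p` to the middle term restricts to a map `K ⟶ Y`. Extending that map to `P` and
subtracting makes the lift vanish on `K`, so it descends to a section. -/
lemma splits_of_exists_extension {X Y K P : C} {j : K ⟶ P} {p : P ⟶ X} {w : j ≫ p = 0}
    (hc : E.conf (ShortComplex.mk j p w)) (hP : E.IsProjective P)
    (h : ∀ k : K ⟶ Y, ∃ l : P ⟶ Y, j ≫ l = k) : E.Splits X Y := by
  rintro ⟨M, i, d, wd, hd⟩
  have := epi_of_conf hc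
  have := mono_of_conf hd
  obtain ⟨a, ha⟩ := hP _ _ d p ⟨Y, i, wd, hd⟩
  obtain ⟨k, hk⟩ := ExactStructure.exists_lift hd (j ≫ a) (by rw [Category.assoc, ha, w])
  obtain ⟨l, hl⟩ := h k
  obtain ⟨s, hs⟩ := exists_desc hc (a - l ≫ i) (by
    rw [Preadditive.comp_sub, reassoc_of% hl, hk, sub_self])
  refine ⟨s, ?_⟩
  rw [← cancel_epi p, reassoc_of% hs]
  simp [wd, ha]

lemma splits_of_exists_lift {X Y I Q : C} {j : Y ⟶ I} {p : I ⟶ Q} {w : j ≫ p = 0}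
    (hc : E.conf (ShortComplex.mk j p w)) (hI : E.IsInjective I)
    (h : ∀ k : X ⟶ Q, ∃ l : X ⟶ I, l ≫ p = k) : E.Splits X Y := by
  rintro ⟨M, i, d, wd, hd⟩
  have := mono_of_conf hc
  have := epi_of_conf hd
  obtain ⟨a, ha⟩ := hI _ _ i j ⟨X, d, wd, hd⟩
  obtain ⟨k, hk⟩ := exists_desc hd (a ≫ p) (by rw [reassoc_of% ha, w])
  obtain ⟨l, hl⟩ := h k
  obtain ⟨r, hr⟩ := ExactStructure.exists_lift hc (a - d ≫ l) (by
    rw [Preadditive.sub_comp, Category.assoc, hl, hk, sub_self])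
  refine section_of_retraction hd (r := r) ?_
  rw [← cancel_mono j, Category.assoc, hr, Preadditive.comp_sub, reassoc_of% wd, ha]
  simp

/-- `Ext¹(X, -)` is half exact. -/
lemma Splits.extension_right {X Y₁ Y₂ Y₃ : C} {i : Y₁ ⟶ Y₂} {d : Y₂ ⟶ Y₃} {w : i ≫ d = 0}
    (hP : E.HasEnoughProjectives) (hc : E.conf (ShortComplex.mk i d w))
    (h₁ : E.Splits X Y₁) (h₃ : E.Splits X Y₃) : E.Splits X Y₂ := by
  obtain ⟨P, p, hPp, K, j, wp, hp⟩ := hP X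
  refine splits_of_exists_extension hp hPp fun k => ?_
  obtain ⟨l, hl⟩ := h₃.exists_extension hp (k ≫ d)
  obtain ⟨m, hm⟩ := hPp _ _ d l ⟨_, i, w, hc⟩
  obtain ⟨n, hn⟩ := ExactStructure.exists_lift hc (k - j ≫ m) (by
    simp [hm, hl])
  obtain ⟨o, ho⟩ := h₁.exists_extension hp n
  exact ⟨m + o ≫ i, by rw [Preadditive.comp_add, reassoc_of% ho, hn]; abel⟩

/-- `Ext¹(-, Y)` is half exact. -/
lemma Splits.extension_left {X₁ X₂ X₃ Y : C} {i : X₁ ⟶ X₂} {d : X₂ ⟶ X₃} {w : i ≫ d = 0}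
    (hI : E.HasEnoughInjectives) (hc : E.conf (ShortComplex.mk i d w))
    (h₁ : E.Splits X₁ Y) (h₃ : E.Splits X₃ Y) : E.Splits X₂ Y := by
  obtain ⟨I, j, hIj, Q, p, wp, hp⟩ := hI Y
  refine splits_of_exists_lift hp hIj fun k => ?_
  obtain ⟨l, hl⟩ := h₁.exists_lift hp (i ≫ k)
  obtain ⟨m, hm⟩ := hIj _ _ i l ⟨_, d, w, hc⟩
  obtain ⟨n, hn⟩ := exists_desc hc (k - m ≫ p) (by
    rw [Preadditive.comp_sub, reassoc_of% hm, hl, sub_self])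
  obtain ⟨o, ho⟩ := h₃.exists_lift hp n
  exact ⟨m + d ≫ o, by rw [Preadditive.add_comp, Category.assoc, ho, hn]; abel⟩

/-! ### Vanishing of `Ext²`. -/

/-- If `Ext²(X, Y) = 0`, then a property of two-term Yoneda extensions that is invariant under
morphisms of extensions and holds for the trivial one holds for all of them. -/
lemma of_ext_two {X Y : C} (h : Subsingleton (E.Ext 2 X Y)) (φ : E.YonedaExtension X 2 Y → Prop)
    (hφ : ∀ a b, E.YonedaMap X 2 (𝟙 Y) a b → (φ a ↔ φ b)) {a₀ : E.YonedaExtension X 2 Y}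
    (h₀ : φ a₀) (a : E.YonedaExtension X 2 Y) : φ a := by
  have hab : (Quot.mk _ a : E.Ext 2 X Y) = Quot.mk _ a₀ := h.elim _ _
  have : φ a = φ a₀ := congrArg (Quot.lift (r := E.YonedaMap X 2 (𝟙 Y)) φ
    fun a b hab => propext (hφ a b hab)) hab
  rwa [this]

variable (E) in
/-- The trivial extension `Y = Y → X = X` of degree two. -/
noncomputable def trivialExtension (X Y : C) : E.YonedaExtension X 2 Y :=
  ⟨0, ⟨Y, 𝟙 Y, 0, by simp, E.conf_id_zero (isZero_zero C) Y⟩,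
    ⟨X, 0, 𝟙 X, by simp, E.conf_zero_id (isZero_zero C) X⟩⟩

/-- The connecting map of `X` with respect to `j : K ⟶ P`, `p : P ⟶ X` lifts. -/
def ProjectiveLift {X Y K P : C} (j : K ⟶ P) (p : P ⟶ X) (a : E.YonedaExtension X 2 Y) : Prop :=
  ∃ (l : P ⟶ a.2.2.M) (k : K ⟶ a.2.1.M), l ≫ a.2.2.d = p ∧ k ≫ a.2.1.d ≫ a.2.2.i = j ≫ l

/-- Lifts push forward by composition. They pull back because the square between the left-hand
conflations is cartesian. -/
lemma projectiveLift_of_ext_two {X Y K P : C} {j : K ⟶ P} {p : P ⟶ X} (w : j ≫ p = 0)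
    (hP : E.IsProjective P) (h : Subsingleton (E.Ext 2 X Y)) (a : E.YonedaExtension X 2 Y) :
    ProjectiveLift j p a := by
  refine of_ext_two h _ ?_ (a₀ := E.trivialExtension X Y)
    ⟨p, 0, Category.comp_id p, zero_comp.trans w.symm⟩ a
  rintro ⟨Z, ⟨M, i, d, wM, hM⟩, ⟨N, i', d', wN, hN⟩⟩ ⟨Z', ⟨M', m, e, wM', hM'⟩,
    ⟨N', m', e', wN', hN'⟩⟩ ⟨g, z, hg, hgz, n, hzn, hn⟩
  dsimp only at g z hg hgz n hzn hn
  constructor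
  · rintro ⟨l, k, hl, hk⟩
    dsimp only at l k hl hk
    refine ⟨l ≫ n, k ≫ g, ?_, ?_⟩
    · dsimp only
      rw [Category.assoc, hn, hl]
    · dsimp only
      rw [Category.assoc, reassoc_of% hgz, ← hzn, ← reassoc_of% hk]
  · rintro ⟨l, k, hl, hk⟩
    dsimp only at l k hl hk
    have := mono_of_conf hN'
    obtain ⟨l₀, hl₀⟩ := hP _ _ d' p ⟨_, i', wN, hN⟩
    obtain ⟨k₀, hk₀⟩ := ExactStructure.exists_lift hN (j ≫ l₀) (by rw [Category.assoc, hl₀, w])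
    -- The lifts `l₀ ≫ n` and `l` of `p` differ by a map `t` into `Z'`. As `P` is projective, `t`
    -- lifts along `e`, and this lift corrects `k`.
    obtain ⟨t, ht⟩ := ExactStructure.exists_lift hN' (l₀ ≫ n - l) (by
      rw [Preadditive.sub_comp, Category.assoc, hn, hl₀, hl, sub_self])
    obtain ⟨t', ht'⟩ := hP _ _ e t ⟨_, m, wM', hM'⟩
    have hkz : (k + j ≫ t') ≫ e = k₀ ≫ z := by
      rw [← cancel_mono m']
      simp only [Preadditive.add_comp, Category.assoc, ht', ht, hk, ← hzn, reassoc_of% hk₀,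
        Preadditive.comp_sub]
      abel
    obtain ⟨c, hcd⟩ := exists_lift_of_morphism hM hM' (g := g) (by simpa using hg) hgz hkz
    exact ⟨l₀, c, hl₀, by dsimp only; rw [reassoc_of% hcd, hk₀]⟩

/-- The connecting map of `Y` with respect to `j : Y ⟶ I`, `p : I ⟶ Q` extends. -/
def InjectiveExtension {X Y I Q : C} (j : Y ⟶ I) (p : I ⟶ Q) (a : E.YonedaExtension X 2 Y) :
    Prop :=
  ∃ (l : a.2.1.M ⟶ I) (k : a.2.2.M ⟶ Q), a.2.1.i ≫ l = j ∧ a.2.1.d ≫ a.2.2.i ≫ k = l ≫ p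

lemma injectiveExtension_of_ext_two {X Y I Q : C} {j : Y ⟶ I} {p : I ⟶ Q} (w : j ≫ p = 0)
    (hI : E.IsInjective I) (h : Subsingleton (E.Ext 2 X Y)) (a : E.YonedaExtension X 2 Y) :
    InjectiveExtension j p a := by
  refine of_ext_two h _ ?_ (a₀ := E.trivialExtension X Y)
    ⟨j, 0, by simp [trivialExtension], by simp [trivialExtension, w]⟩ a
  rintro ⟨Z, ⟨M, i, d, wM, hM⟩, ⟨N, i', d', wN, hN⟩⟩ ⟨Z', ⟨M', m, e, wM', hM'⟩,
    ⟨N', m', e', wN', hN'⟩⟩ ⟨g, z, hg, hgz, n, hzn, hn⟩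
  dsimp only at g z hg hgz n hzn hn
  rw [Category.id_comp] at hg
  constructor
  · rintro ⟨l, k, hl, hk⟩
    dsimp only at l k hl hk
    have := epi_of_conf hM
    obtain ⟨l₀, hl₀⟩ := hI _ _ m j ⟨_, e, wM', hM'⟩
    obtain ⟨k₀, hk₀⟩ := exists_desc hM' (l₀ ≫ p) (by rw [reassoc_of% hl₀, w])
    obtain ⟨t, ht⟩ := exists_desc hM (g ≫ l₀ - l) (by
      rw [Preadditive.comp_sub, reassoc_of% hg, hl₀, hl, sub_self])
    obtain ⟨t', ht'⟩ := hI _ _ i' t ⟨_, d', wN, hN⟩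
    have hkz : i' ≫ (k + t' ≫ p) = z ≫ k₀ := by
      rw [← cancel_epi d]
      simp only [Preadditive.comp_add, reassoc_of% ht', reassoc_of% ht, hk, ← reassoc_of% hgz,
        hk₀, Preadditive.sub_comp, Category.assoc]
      abel
    obtain ⟨c, hcd⟩ := exists_desc_of_morphism hN hN' hn hzn.symm hkz
    exact ⟨l₀, c, hl₀, by dsimp only; rw [hcd, hk₀]⟩
  · rintro ⟨l, k, hl, hk⟩
    dsimp only at l k hl hk
    refine ⟨g ≫ l, n ≫ k, ?_, ?_⟩
    · dsimp only
      rw [reassoc_of% hg, hl]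
    · dsimp only
      rw [reassoc_of% hzn, ← reassoc_of% hgz, hk, Category.assoc]

/-- Exactness of `Ext¹(X, W) ⟶ Ext¹(X, B) ⟶ Ext²(X, Y)` for a conflation `Y ↣ W ↠ B`. -/
lemma Splits.quotient {X Y W B : C} {i : Y ⟶ W} {d : W ⟶ B} {w : i ≫ d = 0}
    (hP : E.HasEnoughProjectives) (hc : E.conf (ShortComplex.mk i d w))
    (h : Subsingleton (E.Ext 2 X Y)) (hW : E.Splits X W) : E.Splits X B := by
  obtain ⟨P, p, hPp, K, j, wp, hp⟩ := hP X
  intro a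
  -- Splicing `a` with the given conflation makes `k` a lift to `W` of the connecting map `K ⟶ B`.
  -- Once `k` is extended to `P`, subtracting it from `l` leaves a lift of `p` that vanishes on `K`.
  obtain ⟨l, k, hl, hk⟩ := projectiveLift_of_ext_two wp hPp h ⟨B, ⟨W, i, d, w, hc⟩, a⟩
  dsimp only at l k hl hk
  obtain ⟨k', hk'⟩ := hW.exists_extension hp k
  obtain ⟨s, hs⟩ := exists_desc hp (l - k' ≫ d ≫ a.i) (by
    rw [Preadditive.comp_sub, reassoc_of% hk', hk, sub_self])
  have := epi_of_conf hp
  refine ⟨s, ?_⟩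
  rw [← cancel_epi p, reassoc_of% hs]
  simp [hl, a.zero]

/-- Exactness of `Ext¹(W, Y) ⟶ Ext¹(B, Y) ⟶ Ext²(X, Y)` for a conflation `B ↣ W ↠ X`. -/
lemma Splits.subobject {X Y W B : C} {i : B ⟶ W} {d : W ⟶ X} {w : i ≫ d = 0}
    (hI : E.HasEnoughInjectives) (hc : E.conf (ShortComplex.mk i d w))
    (h : Subsingleton (E.Ext 2 X Y)) (hW : E.Splits W Y) : E.Splits B Y := by
  obtain ⟨I, j, hIj, Q, p, wp, hp⟩ := hI Y
  intro a
  obtain ⟨l, k, hl, hk⟩ := injectiveExtension_of_ext_two wp hIj h ⟨B, a, ⟨W, i, d, w, hc⟩⟩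
  dsimp only at l k hl hk
  obtain ⟨k', hk'⟩ := hW.exists_lift hp k
  obtain ⟨r, hr⟩ := ExactStructure.exists_lift hp (l - a.d ≫ i ≫ k') (by
    simp only [Preadditive.sub_comp, Category.assoc, hk', hk, sub_self])
  have := mono_of_conf hp
  refine section_of_retraction a.conf (r := r) ?_
  rw [← cancel_mono j, Category.assoc, hr, Preadditive.comp_sub, reassoc_of% a.zero, hl]
  simp

end ExactStructure

/-! ### Closure properties of additive subcategories. -/

section Additive

variable {C : Type u} [Category.{v} C] [Preadditive C] [HasZeroObject C] [HasBinaryBiproducts C]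
  {P : ObjectProperty C}

lemma IsAdditiveSummandClosed.of_iso (hP : IsAdditiveSummandClosed P) {X Y : C} (e : X ≅ Y)
    (hX : P X) : P Y :=
  hP.summand Y 0 X ⟨e ≪≫ isoBiprodZero (isZero_zero C)⟩ hX

lemma IsAdditiveSummandClosed.of_isZero (hP : IsAdditiveSummandClosed P) {X : C} (hX : IsZero X) :
    P X :=
  let ⟨_, hZ, h⟩ := hP.zero
  hP.of_iso (hZ.iso hX) h

lemma IsAdditiveSummandClosed.inf {Q : ObjectProperty C} (hP : IsAdditiveSummandClosed P)
    (hQ : IsAdditiveSummandClosed Q) : IsAdditiveSummandClosed (P ⊓ Q) where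
  zero := ⟨0, isZero_zero C, hP.of_isZero (isZero_zero C), hQ.of_isZero (isZero_zero C)⟩
  sum X Y hX hY := ⟨hP.sum X Y hX.1 hY.1, hQ.sum X Y hX.2 hY.2⟩
  summand X Y Z e hZ := ⟨hP.summand X Y Z e hZ.1, hQ.summand X Y Z e hZ.2⟩

end Additive

/-! ### Cotorsion pairs and twin cotorsion pairs. -/

namespace ExactStructure

variable {C : Type u} [Category.{v} C] [Preadditive C]
variable [HasZeroObject C] [HasBinaryBiproducts C]
variable {E : ExactStructure C} {S T U V : ObjectProperty C}

lemma IsCotorsionPair.splits (h : E.IsCotorsionPair U V) {X Y : C} (hX : U X) (hY : V Y) :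
    E.Splits X Y :=
  splits_of_ext_one (h.ext_one X Y hX hY)

/-- For the converse, the approximation `Y ↣ V' ↠ U'` splits, so `Y` is a summand of `V'`. -/
lemma IsCotorsionPair.right_iff (h : E.IsCotorsionPair U V) (Y : C) :
    V Y ↔ ∀ X, U X → E.Splits X Y := by
  refine ⟨fun hY X hX => h.splits hX hY, fun hY => ?_⟩
  obtain ⟨V', U', i, d, w, hV, hU, hc⟩ := h.exists_right Y
  obtain ⟨s, hs⟩ := hY U' hU ⟨_, i, d, w, hc⟩
  exact h.right.summand _ _ _ (nonempty_iso_biprod hc hs) hV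

lemma IsCotorsionPair.left_iff (h : E.IsCotorsionPair U V) (X : C) :
    U X ↔ ∀ Y, V Y → E.Splits X Y := by
  refine ⟨fun hX Y hY => h.splits hX hY, fun hX => ?_⟩
  obtain ⟨V', U', i, d, w, hV, hU, hc⟩ := h.exists_left X
  obtain ⟨s, hs⟩ := hX V' hV ⟨_, i, d, w, hc⟩
  obtain ⟨e⟩ := nonempty_iso_biprod hc hs
  exact h.left.summand _ V' _ ⟨e ≪≫ biprod.braiding _ _⟩ hU

lemma IsTwinCotorsionPair.right_le (h : E.IsTwinCotorsionPair S T U V) : V ≤ T := fun Y hY =>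
  (h.fst.right_iff Y).2 fun X hX => h.snd.splits (h.le X hX) hY

/-- In the `(U, V)`-approximation of `B`, the middle term is an extension of `B` by an object of `V
≤ T`, hence lies in `T`. -/
lemma IsTwinCotorsionPair.le_plus (h : E.IsTwinCotorsionPair S T U V)
    (hP : E.HasEnoughProjectives) : T ≤ E.plus T U V := by
  intro B hB
  obtain ⟨V', U', i, d, w, hV, hU, hc⟩ := h.snd.exists_left B
  refine ⟨V', U', i, d, w, hV, ⟨(h.fst.right_iff U').2 fun X hX => ?_, hU⟩, hc⟩
  exact Splits.extension_right hP hc (h.fst.splits hX (h.right_le _ hV)) (h.fst.splits hX hB)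

lemma IsTwinCotorsionPair.le_minus (h : E.IsTwinCotorsionPair S T U V)
    (hI : E.HasEnoughInjectives) : U ≤ E.minus S T U := by
  intro B hB
  obtain ⟨T', S', i, d, w, hT, hS, hc⟩ := h.fst.exists_right B
  refine ⟨T', S', i, d, w, ⟨hT, (h.snd.left_iff T').2 fun Y hY => ?_⟩, hS, hc⟩
  exact Splits.extension_left hI hc (h.snd.splits hB hY) (h.snd.splits (h.le _ hS) hY)

lemma IsTwinCotorsionPair.plus_eq (h : E.IsTwinCotorsionPair S T U V)
    (hP : E.HasEnoughProjectives) (hh : E.IsHereditary S T) : E.plus T U V = T := by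
  refine le_antisymm ?_ (h.le_plus hP)
  rintro B ⟨V', W', i, d, w, hV, hW, hc⟩
  exact (h.fst.right_iff B).2 fun X hX =>
    (h.fst.splits hX hW.1).quotient hP hc (hh 2 two_pos X V' hX (h.right_le _ hV))

lemma IsTwinCotorsionPair.minus_eq (h : E.IsTwinCotorsionPair S T U V)
    (hI : E.HasEnoughInjectives) (hh : E.IsHereditary U V) : E.minus S T U = U := by
  refine le_antisymm ?_ (h.le_minus hI)
  rintro B ⟨W', S', i, d, w, hW, hS, hc⟩
  exact (h.snd.left_iff B).2 fun Y hY =>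
    (h.snd.splits hW.2 hY).subobject hI hc (hh 2 two_pos S' Y (h.le _ hS) hY)

lemma IsTwinCotorsionPair.minus_inf_le (h : E.IsTwinCotorsionPair S T U V) {B : C} (hB : T B)
    (hB' : E.minus S T U B) : (T ⊓ U) B := by
  obtain ⟨W', S', i, d, w, hW, hS, hc⟩ := hB'
  obtain ⟨s, hs⟩ := h.fst.splits hS hB ⟨_, i, d, w, hc⟩
  exact (h.fst.right.inf h.snd.left).summand _ _ _ (nonempty_iso_biprod hc hs) hW

lemma IsTwinCotorsionPair.plus_inf_le (h : E.IsTwinCotorsionPair S T U V) {B : C} (hB : U B)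
    (hB' : E.plus T U V B) : (T ⊓ U) B := by
  obtain ⟨V', W', i, d, w, hV, hW, hc⟩ := hB'
  obtain ⟨s, hs⟩ := h.snd.splits hB hV ⟨_, i, d, w, hc⟩
  obtain ⟨e⟩ := nonempty_iso_biprod hc hs
  exact (h.fst.right.inf h.snd.left).summand _ V' _ ⟨e ≪≫ biprod.braiding _ _⟩ hW

end ExactStructure

/-- An object of `W` becomes zero in the ideal quotient by `W`. -/
lemma isZero_quotientSubcategory {C : Type u} [Category.{v} C] [Preadditive C]
    {H W : ObjectProperty C} (X : QuotientSubcategory H W) (hX : W X.obj.as) : IsZero X := by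
  have hsrc : ∀ {Y : C} (f g : X.obj.as ⟶ Y),
      (Quotient.functor (factorRel W)).map f = (Quotient.functor (factorRel W)).map g :=
    -- Every morphism from `X` factors through `X`, which is itself in `W`.
    fun f g => CategoryTheory.Quotient.sound _ ⟨_, 𝟙 _, f - g, hX, by simp⟩
  have htgt : ∀ {Y : C} (f g : Y ⟶ X.obj.as),
      (Quotient.functor (factorRel W)).map f = (Quotient.functor (factorRel W)).map g :=
    fun f g => CategoryTheory.Quotient.sound _ ⟨_, f - g, 𝟙 _, hX, by simp⟩
  constructor
  · intro Y
    refine ⟨⟨⟨ObjectProperty.homMk ((Quotient.functor (factorRel W)).map (0 : X.obj.as ⟶ Y.obj.as))⟩,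
      fun f => ?_⟩⟩
    ext
    obtain ⟨f', hf'⟩ := (Quotient.functor (factorRel W)).map_surjective
      (X := X.obj.as) (Y := Y.obj.as) f.hom
    exact hf'.symm.trans (hsrc _ _)
  · intro Y
    refine ⟨⟨⟨ObjectProperty.homMk ((Quotient.functor (factorRel W)).map (0 : Y.obj.as ⟶ X.obj.as))⟩,
      fun f => ?_⟩⟩
    ext
    obtain ⟨f', hf'⟩ := (Quotient.functor (factorRel W)).map_surjective
      (X := Y.obj.as) (Y := X.obj.as) f.hom
    exact hf'.symm.trans (htgt _ _)

theorem proposition10 {C : Type u} [Category.{v} C] [Preadditive C]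
    [HasZeroObject C] [HasBinaryBiproducts C]
    (E : ExactStructure C) (hKS : IsKrullSchmidt C)
    (hP : E.HasEnoughProjectives) (hI : E.HasEnoughInjectives)
    (S T U V : ObjectProperty C) (h : E.IsTwinCotorsionPair S T U V) :
    (E.IsHereditary S T ∨ E.IsHereditary U V → IsZeroCategory (E.Heart S T U V)) ∧
      (E.IsHereditary S T → E.plus T U V = T) ∧
      (E.IsHereditary U V → E.minus S T U = U) := by
  refine ⟨fun hh => ⟨?_, fun X => isZero_quotientSubcategory X ?_⟩, h.plus_eq hP, h.minus_eq hI⟩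
  · have hz := isZero_zero C
    -- The zero object shows that the heart is nonempty.
    exact ⟨⟨⟨0⟩, h.le_plus hP _ (h.fst.right.of_isZero hz),
      h.le_minus hI _ (h.snd.left.of_isZero hz)⟩⟩
  · obtain hh | hh := hh
    · exact h.minus_inf_le ((h.plus_eq hP hh).le _ X.property.1) X.property.2
    · exact h.plus_inf_le ((h.minus_eq hI hh).le _ X.property.2) X.property.1
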